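/- Let $\Omega\subset\mathbb{R}^d$ be a bounded open convex domain which is strictly convex, i.e. $\lambda x+(1-\lambda)x'\in\Omega$ for all $x\ne x'$ in $\overline\Omega$ and $0<\lambda<1$. Let $\mu$ be a non-negative Borel measure on $\Omega$, let $R\in L^1_{\mathrm{loc}}(\mathbb{R}^d)$ with $R(p)>0$ for every $p\in\mathbb{R}^d$, and let $g$ be a real function on $\partial\Omega$. Assume $\mu(\Omega)<\int_{\mathbb{R}^d}R(p)\,dp\in(0,\infty]$. Let $h>0$ and let $\mathcal{T}_h$ be a mesh of $\Omega$: a finite set of closed $d$-simplices contained in $\overline\Omega$ such that any two distinct simplices intersect in a common (possibly empty) proper face, $h=\max_{T\in\mathcal{T}_h}\operatorname{diam}T$, the interior $\Omega_h$ of $\bigcup_{T\in\mathcal{T}_h}T$ is convex, and all vertices (extreme points) $B_1,\dots,B_{m_h}$ of the polytope $\overline{\Omega_h}$ lie on $\partial\Omega$. Let $A_1,\dots,A_{k_h}$ be the vertices of simplices of $\mathcal{T}_h$ lying in $\Omega_h$. For $1\le i\le k_h$ let $\phi_{i,h}$ be the continuous function on $\overline{\Omega_h}$ that is affine on every $T\in\mathcal{T}_h$,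 vanishes on $\partial\Omega_h$, and satisfies $\phi_{i,h}(A_j)=\delta_{ij}$ for $1\le j\le k_h$. For $z\in\mathbb{R}^{k_h}$ let $M_h(z)\subset\mathbb{R}^{d+1}$ be the convex hull of $\{(A_i,z_i)\}_{i=1}^{k_h}\cup\{(B_j,g(B_j))\}_{j=1}^{m_h}$, and let $H_h$ be the set of functions $v\in C(\overline{\Omega_h})$, convex on $\Omega_h$, for which there is $z\in\mathbb{R}^{k_h}$ with $v(x)=\inf\{t:(x,t)\in M_h(z)\}$ for all $x\in\overline{\Omega_h}$. For $v\in H_h$ and $x_0\in\Omega_h$ let $\partial v(x_0)=\{p\in\mathbb{R}^d: v(x)\ge v(x_0)+p\cdot(x-x_0)\ \ \forall x\in\Omega_h\}$. Then there is exactly one function $u_h\in H_h$ such that $$\int_{\partial u_h(A_i)}R(p)\,dp=\int_{\Omega_h}\phi_{i,h}\,d\mu\qquad\text{for all }1\le i\le k_h .$$ -/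

import Mathlib

open MeasureTheory Set

namespace FEM

/-- `ℝ^d` with its Euclidean norm and Lebesgue measure. -/
abbrev Space (d : ℕ) : Type := EuclideanSpace ℝ (Fin d)

/-- Strict convexity of a domain: every open segment between two distinct points of the closure
lies in the domain. -/
def IsStrictlyConvexDomain {d : ℕ} (Ω : Set (Space d)) : Prop :=
  ∀ x ∈ closure Ω, ∀ y ∈ closure Ω, x ≠ y →
    ∀ l : ℝ, 0 < l → l < 1 → l • x + (1 - l) • y ∈ Ω

/-- The (closed) simplex with vertex set `s`. -/
def simplex {d : ℕ} (s : Finset (Space d)) : Set (Space d) :=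
  convexHull ℝ (s : Set (Space d))

/-- `Ω_h`, the interior of the closure of the union of all the simplices. -/
def meshDomain {d : ℕ} (T : Finset (Finset (Space d))) : Set (Space d) :=
  interior (closure (⋃ s ∈ T, simplex s))

/-- The vertices of the polytope `closure Ω_h`, that is, its extreme points. -/
def boundaryVertices {d : ℕ} (T : Finset (Finset (Space d))) : Set (Space d) :=
  (closure (meshDomain T)).extremePoints ℝ

/-- The vertices of the simplices of the mesh that lie in the open set `Ω_h`. -/
def interiorNodes {d : ℕ} (T : Finset (Finset (Space d))) : Set (Space d) :=
  {A | (∃ s ∈ T, A ∈ s) ∧ A ∈ meshDomain T}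

/-- `T` is a mesh of `Ω` of mesh size `h`. A `d`-simplex is given by its set of `d + 1` affinely
independent vertices. -/
structure IsMesh {d : ℕ} (Ω : Set (Space d)) (h : ℝ) (T : Finset (Finset (Space d))) : Prop where
  card_eq : ∀ s ∈ T, s.card = d + 1
  affineIndependent : ∀ s ∈ T, AffineIndependent ℝ ((↑) : s → Space d)
  subset_closure : ∀ s ∈ T, simplex s ⊆ closure Ω
  /-- Two distinct simplices meet in a common face (possibly empty); it is proper, since the
  vertex sets are distinct and have the same cardinality. -/
  face_to_face : ∀ s ∈ T, ∀ t ∈ T, s ≠ t →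
    ∃ f : Finset (Space d), f ⊆ s ∧ f ⊆ t ∧ simplex s ∩ simplex t = simplex f
  size_pos : 0 < h
  size_eq : IsGreatest {r : ℝ | ∃ s ∈ T, r = Metric.diam (simplex s)} h
  convex_domain : Convex ℝ (meshDomain T)
  boundaryVertices_subset : boundaryVertices T ⊆ frontier Ω

/-- `M_h(z)`: the convex hull in `ℝ^d × ℝ` of the points `(A, z A)`, `A` an interior node, and
`(B, g B)`, `B` a boundary vertex. -/
def hullM {d : ℕ} (T : Finset (Finset (Space d))) (g z : Space d → ℝ) : Set (Space d × ℝ) :=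
  convexHull ℝ ((fun A => (A, z A)) '' interiorNodes T ∪ (fun B => (B, g B)) '' boundaryVertices T)

/-- `H_h`: functions that are convex on `Ω_h`, continuous on its closure, and there equal to the
lower boundary of some `M_h(z)`. Only the values on `closure Ω_h` matter. -/
def spaceH {d : ℕ} (T : Finset (Finset (Space d))) (g : Space d → ℝ) : Set (Space d → ℝ) :=
  {v | ConvexOn ℝ (meshDomain T) v ∧ ContinuousOn v (closure (meshDomain T)) ∧
    ∃ z : Space d → ℝ, ∀ x ∈ closure (meshDomain T), IsGLB {t : ℝ | (x, t) ∈ hullM T g z} (v x)}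

/-- The subdifferential at `x₀` of a function `u` on the domain `D`. -/
def subdifferential {d : ℕ} (D : Set (Space d)) (u : Space d → ℝ) (x₀ : Space d) :
    Set (Space d) :=
  {p | ∀ x ∈ D, u x₀ + inner ℝ p (x - x₀) ≤ u x}

/-- `φ` is the nodal basis function of the interior node `A`: continuous on `closure Ω_h`, zero on
`∂Ω_h`, affine on each simplex, equal to `1` at `A` and to `0` at every other interior node. These
conditions determine `φ` on `closure Ω_h`, where `0 ≤ φ ≤ 1`. -/
structure IsNodalBasisFunction {d : ℕ} (T : Finset (Finset (Space d))) (A : Space d)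
    (φ : Space d → ℝ) : Prop where
  continuousOn : ContinuousOn φ (closure (meshDomain T))
  eq_zero : ∀ x ∈ frontier (meshDomain T), φ x = 0
  affine : ∀ s ∈ T, ∃ L : Space d →ᵃ[ℝ] ℝ, EqOn φ L (simplex s)
  eq_one : φ A = 1
  eq_zero_of_ne : ∀ A' ∈ interiorNodes T, A' ≠ A → φ A' = 0

/-- `u` solves the discrete scheme: `u ∈ H_h`, and at each interior node `A` the integral of `R`
over the subdifferential of `u` at `A` equals the `μ`-integral over `Ω_h` of the nodal basis
function of `A`. -/
def IsDiscreteSolution {d : ℕ} (T : Finset (Finset (Space d))) (μ : Measure (Space d))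
    (R g u : Space d → ℝ) : Prop :=
  u ∈ spaceH T g ∧ ∀ A ∈ interiorNodes T, ∃ φ : Space d → ℝ, IsNodalBasisFunction T A φ ∧
    ∫⁻ p in subdifferential (meshDomain T) u A, ENNReal.ofReal (R p) =
      ∫⁻ x in meshDomain T, ENNReal.ofReal (φ x) ∂μ

end FEM

/-!
Write `N` for the interior nodes, `B` for the vertices of the polytope and `X = N ∪ B`. A function of
`H_h` is the lower envelope of its own nodal values, so a slope supports it at a node as soon as it
does so at all points of the finite set `X` (`subdifferential_meshDomain_eq`). This turns the scheme
into a problem for finitely many nodal values: with `ν` the measure of density `R`, find `w` with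
`w = g` on `B` and `ν (subdifferential X w A) = m A` on `N`, where `m A` is the integral of the nodal
basis function of `A`. The nodal basis functions are non-negative with sum at most one, whence
`∑ m A ≤ μ Ω < ν univ` (`IsMesh.sum_setLIntegral_nodalBasis_le`).

Existence (`exists_measure_subdifferential_eq`) follows Alexandrov and Perron. Consider the nodal
values for which every `ν (subdifferential X w A)` is at most `m A`. They form a nonempty closed set
that is bounded below: if one value were very low, all slopes of a ball of `ν`-measure larger than
`∑ m A` would support `w` at interior nodes. At a point of this set with minimal sum equality holds
at each node, for otherwise the value at that node could be lowered a little. The passage from nodal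
values to the lower envelope changes each subdifferential by a null set only
(`measure_subdifferential_envelope`), and the envelope is continuous up to the boundary
(`continuousOn_of_isGLB_hullM`).

Uniqueness is a comparison principle (`le_of_measure_subdifferential_eq`): where `v - u` attains a
positive maximum over the nodes, the subdifferentials of `v` lie in the interior of those of `u`,
which is incompatible with equal `ν`-measures because `R > 0`. Hence two solutions agree at the
nodes, and therefore everywhere.
-/

/-! ### Subdifferentials of nodal functions and the comparison principle -/

namespace FEM

variable {d : ℕ}

/-- The slopes `p` for which the affine function `x ↦ w A + ⟪p, x - A⟫` lies strictly below `w`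
at all the points of `X` other than `A`. -/
def strictSubdifferential (X : Set (Space d)) (w : Space d → ℝ) (A : Space d) :
    Set (Space d) :=
  {p | ∀ x ∈ X, x ≠ A → w A + inner ℝ p (x - A) < w x}

theorem volume_setOf_inner_eq {a : Space d} (ha : a ≠ 0) (c : ℝ) :
    volume {p : Space d | inner ℝ p a = c} = 0 := by
  rcases eq_empty_or_nonempty {p : Space d | inner ℝ p a = c} with h | ⟨q, hq⟩
  · simp [h]
  let s : AffineSubspace ℝ (Space d) := AffineSubspace.mk' q (LinearMap.ker (innerₛₗ ℝ a))
  have hs : {p : Space d | inner ℝ p a = c} = s := by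
    ext p
    have hq' : inner ℝ q a = c := hq
    change _ = _ ↔ p ∈ AffineSubspace.mk' q _
    rw [AffineSubspace.mem_mk', LinearMap.mem_ker, vsub_eq_sub, innerₛₗ_apply_apply,
      inner_sub_right, real_inner_comm, real_inner_comm q a, hq', sub_eq_zero]
  rw [hs]
  refine Measure.addHaar_affineSubspace _ _ fun h => ha ?_
  have h1 : q + a ∈ s := by rw [h]; trivial
  have h2 : q + a ∈ AffineSubspace.mk' q (LinearMap.ker (innerₛₗ ℝ a)) := h1
  rw [AffineSubspace.mem_mk', LinearMap.mem_ker, vsub_eq_sub, innerₛₗ_apply_apply,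
    add_sub_cancel_left] at h2
  exact inner_self_eq_zero.1 h2

theorem isClosed_subdifferential (X : Set (Space d)) (w : Space d → ℝ) (A : Space d) :
    IsClosed (subdifferential X w A) := by
  have : subdifferential X w A = ⋂ x ∈ X, {p | w A + inner ℝ p (x - A) ≤ w x} := by
    ext p; simp [subdifferential]
  rw [this]
  exact isClosed_biInter fun x _ => isClosed_le (by fun_prop) continuous_const

theorem strictSubdifferential_subset (X : Set (Space d)) (w : Space d → ℝ) (A : Space d) :
    strictSubdifferential X w A ⊆ subdifferential X w A := by
  intro p hp x hx
  by_cases h : x = A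
  · simp [h]
  · exact (hp x hx h).le

/-- A subset of a finite union of hyperplanes, each orthogonal to some `x - A`, is null. -/
theorem measure_eq_zero_of_forall_exists_inner_eq {ν : Measure (Space d)} (hν : ν ≪ volume)
    {X : Set (Space d)} (hX : X.Finite) {A : Space d} (c : Space d → ℝ) {s : Set (Space d)}
    (hs : ∀ p ∈ s, ∃ x ∈ X, x ≠ A ∧ inner ℝ p (x - A) = c x) : ν s = 0 := by
  apply hν
  refine measure_mono_null (t := ⋃ x ∈ X \ {A}, {p : Space d | inner ℝ p (x - A) = c x}) ?_ ?_
  · intro p hp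
    obtain ⟨x, hx, hxA, h⟩ := hs p hp
    exact mem_biUnion (show x ∈ X \ {A} from ⟨hx, hxA⟩) h
  · rw [measure_biUnion_null_iff (hX.subset sdiff_subset).countable]
    exact fun x hx => volume_setOf_inner_eq (sub_ne_zero.2 hx.2) _

theorem measure_strictSubdifferential {ν : Measure (Space d)} (hν : ν ≪ volume)
    {X : Set (Space d)} (hX : X.Finite) (w : Space d → ℝ) (A : Space d) :
    ν (strictSubdifferential X w A) = ν (subdifferential X w A) := by
  refine le_antisymm (measure_mono (strictSubdifferential_subset X w A)) ?_
  have h0 : ν (subdifferential X w A \ strictSubdifferential X w A) = 0 := by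
    refine measure_eq_zero_of_forall_exists_inner_eq hν hX (A := A) (fun x => w x - w A) ?_
    rintro p ⟨hp, hp'⟩
    simp only [strictSubdifferential, mem_ofPred_eq, not_forall, not_lt] at hp'
    obtain ⟨x, hx, hxA, h⟩ := hp'
    exact ⟨x, hx, hxA, by linarith [hp x hx]⟩
  calc ν (subdifferential X w A)
      ≤ ν (strictSubdifferential X w A ∪
          subdifferential X w A \ strictSubdifferential X w A) :=
        measure_mono fun p hp => by
          by_cases h : p ∈ strictSubdifferential X w A
          exacts [Or.inl h, Or.inr ⟨hp, h⟩]
    _ ≤ _ := measure_union_le _ _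
    _ = _ := by rw [h0, add_zero]

/-- The boundary values bound `⟪p, y - A⟫` for every `y` of the convex hull, in particular for `y` in
a ball about `A`. -/
theorem isBounded_subdifferential {X B : Set (Space d)} (hB : B.Finite) (hBX : B ⊆ X)
    (w : Space d → ℝ) {A : Space d} (hA : A ∈ interior (convexHull ℝ B)) :
    Bornology.IsBounded (subdifferential X w A) := by
  obtain ⟨r, hr, hball⟩ := Metric.isOpen_iff.1 isOpen_interior A hA
  obtain ⟨C, hC⟩ := (hB.image w).bddAbove
  have key : ∀ p ∈ subdifferential X w A, ∀ y ∈ convexHull ℝ B, inner ℝ p (y - A) ≤ C - w A := by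
    intro p hp
    have hconv : Convex ℝ {y : Space d | inner ℝ p (y - A) ≤ C - w A} := by
      have : {y : Space d | inner ℝ p (y - A) ≤ C - w A} =
          {y | (innerₛₗ ℝ p) y ≤ C - w A + inner ℝ p A} := by
        ext y; simp [inner_sub_right]
      rw [this]
      exact convex_halfSpace_le (innerₛₗ ℝ p).isLinear _
    refine convexHull_min (fun b hb => ?_) hconv
    have := hp b (hBX hb)
    have := hC (mem_image_of_mem w hb)
    change inner ℝ p (b - A) ≤ C - w A
    linarith
  refine (Metric.isBounded_closedBall (x := (0 : Space d)) (r := 2 * (C - w A) / r)).subset ?_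
  intro p hp
  rw [mem_closedBall_zero_iff]
  rcases eq_or_ne p 0 with rfl | hp0
  · have := key 0 hp A (interior_subset hA)
    simp only [inner_zero_left] at this
    simp only [norm_zero]; positivity
  have hn : 0 < ‖p‖ := norm_pos_iff.2 hp0
  have := key p hp (A + (r / 2 / ‖p‖) • p) (interior_subset (hball ?_))
  · rw [add_sub_cancel_left, inner_smul_right, real_inner_self_eq_norm_sq] at this
    have e : r / 2 / ‖p‖ * ‖p‖ ^ 2 = r * ‖p‖ / 2 := by field_simp
    rw [e] at this
    rw [le_div_iff₀ hr]; linarith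
  · rw [Metric.mem_ball, dist_self_add_left, norm_smul, Real.norm_eq_abs, abs_of_pos (by positivity),
      div_mul_cancel₀ _ hn.ne']
    linarith

/-- Comparison principle: nodal functions with the same boundary values and the same subdifferential
measures are ordered. At an interior node carrying the largest excess of `v` over `u`, every slope
supporting `v` supports `u` as well, and does so strictly at the nodes with a smaller excess. The
union of the subdifferentials of `v` over the nodes of largest excess is then compact and contained
in the interior of the corresponding union for `u`; as the two unions differ by a null set, the
union for `v` would be open and closed. -/
theorem le_of_measure_subdifferential_eq [Nontrivial (Space d)] {ν : Measure (Space d)}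
    (hν : volume ≪ ν) {N B : Set (Space d)} (hN : N.Finite) (hB : B.Finite)
    (hNB : N ⊆ interior (convexHull ℝ B)) {u v : Space d → ℝ} (huv : EqOn u v B)
    (heq : ∀ A ∈ N, ν (subdifferential (N ∪ B) u A) = ν (subdifferential (N ∪ B) v A))
    (hfin : ∀ A ∈ N, ν (subdifferential (N ∪ B) v A) ≠ ⊤)
    (hne : ∀ A ∈ N, (subdifferential (N ∪ B) v A).Nonempty) :
    ∀ A ∈ N, v A ≤ u A := by
  intro A₁ hA₁
  obtain ⟨A₀, hA₀, hmax⟩ := hN.exists_maximalFor (fun A => v A - u A) N ⟨A₁, hA₁⟩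
  replace hmax : ∀ A ∈ N, v A - u A ≤ v A₀ - u A₀ := fun A hA => by
    by_contra! h
    exact h.not_ge (hmax hA h.le)
  by_contra! hlt
  set δ := v A₀ - u A₀ with hδ
  have hδpos : 0 < δ := by linarith [hmax A₁ hA₁]
  have hX : (N ∪ B).Finite := hN.union hB
  set S : Set (Space d) := {A ∈ N | v A - u A = δ} with hS
  have hSN : S ⊆ N := fun A hA => hA.1
  have hSfin : S.Finite := hN.subset hSN
  set Kv := ⋃ A ∈ S, subdifferential (N ∪ B) v A with hKv
  set Ku := ⋃ A ∈ S, subdifferential (N ∪ B) u A with hKu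
  have hsub : ∀ A ∈ S, subdifferential (N ∪ B) v A ⊆ subdifferential (N ∪ B) u A := by
    rintro A ⟨hA, hAδ⟩ p hp x hx
    have := hp x hx
    rcases hx with hx | hx
    · linarith [hmax x hx]
    · linarith [huv hx]
  have hstrict : ∀ A ∈ S, ∀ p ∈ subdifferential (N ∪ B) v A, ∀ x ∈ (N ∪ B) \ S,
      u A + inner ℝ p (x - A) < u x := by
    rintro A ⟨hA, hAδ⟩ p hp x ⟨hx, hxS⟩
    have := hp x hx
    rcases hx with hx | hx
    · have h1 : v x - u x ≠ δ := fun h => hxS ⟨hx, h⟩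
      linarith [lt_of_le_of_ne (hmax x hx) h1]
    · linarith [huv hx]
  -- Near a slope of `Kv`, the minimum of `u - ⟪p, ·⟫` over the nodes is attained in `S`.
  have hint : Kv ⊆ interior Ku := by
    intro p hp
    obtain ⟨A, hA, hpA⟩ := mem_iUnion₂.1 hp
    rw [mem_interior_iff_mem_nhds]
    have hev : ∀ᶠ q in nhds p, ∀ x ∈ (N ∪ B) \ S, u A + inner ℝ q (x - A) < u x := by
      refine (Filter.eventually_all_finite (hX.subset sdiff_subset)).2 fun x hx => ?_
      have hc : Continuous fun q : Space d => u A + inner ℝ q (x - A) := by fun_prop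
      exact hc.continuousAt.eventually_lt continuousAt_const (hstrict A hA p hpA x hx)
    filter_upwards [hev] with q hq
    obtain ⟨x₀, hx₀, hmin⟩ := hX.exists_minimalFor (fun x => u x - inner ℝ q x) (N ∪ B)
      ⟨A, Or.inl (hSN hA)⟩
    replace hmin : ∀ x ∈ N ∪ B, u x₀ - inner ℝ q x₀ ≤ u x - inner ℝ q x := fun x hx => by
      by_contra! h
      exact h.not_ge (hmin hx h.le)
    have hx₀S : x₀ ∈ S := by
      by_contra h
      have h1 := hq x₀ ⟨hx₀, h⟩
      have h2 := hmin A (Or.inl (hSN hA))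
      rw [inner_sub_right] at h1
      linarith
    refine mem_biUnion hx₀S fun x hx => ?_
    have := hmin x hx
    rw [inner_sub_right]; linarith
  have hKvclosed : IsClosed Kv :=
    hSfin.isClosed_biUnion fun A _ => isClosed_subdifferential _ _ _
  have hnull : ν (interior Ku \ Kv) = 0 := by
    refine measure_mono_null
      (t := ⋃ A ∈ S, subdifferential (N ∪ B) u A \ subdifferential (N ∪ B) v A) ?_ ?_
    · rintro p ⟨hp, hpv⟩
      obtain ⟨A, hA, hpA⟩ := mem_iUnion₂.1 (interior_subset hp)
      exact mem_biUnion hA ⟨hpA, fun h => hpv (mem_biUnion hA h)⟩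
    · rw [measure_biUnion_null_iff hSfin.countable]
      intro A hA
      rw [measure_sdiff (hsub A hA) (isClosed_subdifferential _ _ _).measurableSet.nullMeasurableSet
        (hfin A (hSN hA)), heq A (hSN hA), tsub_self]
  -- A null open set is empty, so `Kv` is all of the interior of `Ku`.
  have hempty : interior Ku \ Kv = ∅ :=
    (isOpen_interior.sdiff hKvclosed).measure_eq_zero_iff (μ := volume) |>.1 (hν hnull)
  have hKvopen : IsOpen Kv := by
    rw [hint.antisymm (sdiff_eq_empty.1 hempty)]
    exact isOpen_interior
  have hbdd : Bornology.IsBounded Kv :=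
    (Bornology.isBounded_biUnion hSfin).2 fun A hA =>
      isBounded_subdifferential hB subset_union_right v (hNB (hSN hA))
  rcases isClopen_iff.1 ⟨hKvclosed, hKvopen⟩ with h | h
  · obtain ⟨p, hp⟩ := hne A₀ hA₀
    have : p ∈ Kv := mem_biUnion (show A₀ ∈ S from ⟨hA₀, rfl⟩) hp
    simp [h] at this
  · rw [h] at hbdd
    exact NormedSpace.unbounded_univ ℝ (Space d) hbdd

end FEM

/-! ### Existence of nodal values with prescribed subdifferential measures -/

namespace FEM

variable {d : ℕ}

/-- The nodal function with values `z` on the finite set `N` and `g` elsewhere. -/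
noncomputable def nodalExtend (N : Finset (Space d)) (g : Space d → ℝ) (z : N → ℝ) :
    Space d → ℝ := by
  classical exact fun x => if h : x ∈ N then z ⟨x, h⟩ else g x

theorem nodalExtend_coe (N : Finset (Space d)) (g : Space d → ℝ) (z : N → ℝ) (A : N) :
    nodalExtend N g z A = z A := by
  simp [nodalExtend]

theorem nodalExtend_of_notMem {N : Finset (Space d)} (g : Space d → ℝ) (z : N → ℝ) {x : Space d}
    (hx : x ∉ N) : nodalExtend N g z x = g x := by
  simp [nodalExtend, hx]

theorem continuous_nodalExtend (N : Finset (Space d)) (g : Space d → ℝ) (x : Space d) :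
    Continuous fun z => nodalExtend N g z x := by
  by_cases hx : x ∈ N
  · simp only [nodalExtend, hx, dif_pos]; fun_prop
  · simp only [nodalExtend, hx, dif_neg, not_false_eq_true]; fun_prop

theorem nodalExtend_update [DecidableEq (Space d)] (N : Finset (Space d)) (g : Space d → ℝ)
    (z : N → ℝ) (A : N) (c : ℝ) (x : Space d) :
    nodalExtend N g (Function.update z A c) x = if x = A then c else nodalExtend N g z x := by
  by_cases hx : x ∈ N
  · simp only [nodalExtend, hx, dif_pos, Function.update_apply]
    simp [Subtype.ext_iff]
  · have : x ≠ A := fun h => hx (h ▸ A.2)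
    simp [nodalExtend, hx, this]

section Existence

variable {ν : Measure (Space d)} {N : Finset (Space d)} {B : Set (Space d)}

/-- Lower semicontinuity of the mass of the subdifferential: strict support is stable under
small changes of the nodal values. -/
theorem isClosed_setOf_measure_strictSubdifferential_le (X : Set (Space d)) (hX : X.Finite)
    (g : Space d → ℝ) (A : Space d) (c : ENNReal) :
    IsClosed {z : N → ℝ | ν (strictSubdifferential X (nodalExtend N g z) A) ≤ c} := by
  refine IsSeqClosed.isClosed fun z z₀ hz hlim => ?_
  have hsub : strictSubdifferential X (nodalExtend N g z₀) A ⊆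
      ⋃ n, ⋂ k ≥ n, strictSubdifferential X (nodalExtend N g (z k)) A := by
    intro p hp
    have hev : ∀ᶠ k in Filter.atTop, ∀ x ∈ X, x ≠ A →
        nodalExtend N g (z k) A + inner ℝ p (x - A) < nodalExtend N g (z k) x := by
      refine (Filter.eventually_all_finite hX).2 fun x hx => ?_
      by_cases hxA : x = A
      · simp [hxA]
      have h1 := ((continuous_nodalExtend N g A).tendsto z₀).comp hlim
      have h2 := ((continuous_nodalExtend N g x).tendsto z₀).comp hlim
      filter_upwards [(h1.add_const (inner ℝ p (x - A))).eventually_lt h2 (hp x hx hxA)] with k hk _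
      exact hk
    obtain ⟨n, hn⟩ := Filter.eventually_atTop.1 hev
    exact mem_iUnion.2 ⟨n, mem_iInter₂.2 fun k hk => hn k hk⟩
  have hmono : Monotone fun n => ⋂ k ≥ n, strictSubdifferential X (nodalExtend N g (z k)) A :=
    fun a b hab => biInter_subset_biInter_left fun k hk => le_trans hab hk
  refine (measure_mono hsub).trans ?_
  rw [hmono.measure_iUnion]
  exact iSup_le fun n => (measure_mono (biInter_subset_of_mem (le_refl n))).trans (hz n)

/-- If some interior nodal value were below `-L`, every slope of the ball would support the nodal
function at an interior node. -/
theorem exists_forall_le_of_sum_measure_lt (hB : B.Finite) (hNB : Disjoint (N : Set (Space d)) B)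
    (g : Space d → ℝ) {ρ : ℝ} :
    ∃ L : ℝ, ∀ z : N → ℝ,
      ∑ A ∈ N, ν (subdifferential (N ∪ B) (nodalExtend N g z) A) < ν (Metric.ball 0 ρ) →
        ∀ A : N, L ≤ z A := by
  have hX : ((N : Set (Space d)) ∪ B).Finite := N.finite_toSet.union hB
  obtain ⟨G, hG⟩ := (hB.image g).bddBelow
  obtain ⟨D, hD⟩ := (hX.image norm).bddAbove
  refine ⟨G - 2 * (|ρ| * D), fun z hz A => ?_⟩
  by_contra! hlt
  refine hz.not_ge ((measure_mono fun p hp => ?_).trans (measure_biUnion_finset_le N _))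
  obtain ⟨x₀, hx₀, hmin⟩ := hX.exists_minimalFor (fun x => nodalExtend N g z x - inner ℝ p x)
    _ ⟨A, Or.inl A.2⟩
  replace hmin : ∀ x ∈ (N : Set (Space d)) ∪ B, nodalExtend N g z x₀ - inner ℝ p x₀ ≤
      nodalExtend N g z x - inner ℝ p x := fun x hx => by
    by_contra! h
    exact h.not_ge (hmin hx h.le)
  have hpρ : ‖p‖ ≤ |ρ| := (mem_ball_zero_iff.1 hp).le.trans (le_abs_self ρ)
  have hin : ∀ x ∈ (N : Set (Space d)) ∪ B, |inner ℝ p x| ≤ |ρ| * D := fun x hx =>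
    (abs_real_inner_le_norm p x).trans
      (mul_le_mul hpρ (hD (mem_image_of_mem _ hx)) (norm_nonneg _) (abs_nonneg _))
  have hx₀N : x₀ ∈ N := by
    rcases hx₀ with h | h
    · exact h
    exfalso
    have h1 := hmin A (Or.inl A.2)
    have hn : x₀ ∉ N := fun h' => (Set.disjoint_left.1 hNB) h' h
    rw [nodalExtend_coe, nodalExtend_of_notMem g z hn] at h1
    have h2 := (abs_le.1 (hin x₀ (Or.inr h))).2
    have h3 := (abs_le.1 (hin A (Or.inl A.2))).1
    have h4 := hG (mem_image_of_mem g h)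
    linarith
  refine mem_iUnion₂.2 ⟨x₀, hx₀N, fun x hx => ?_⟩
  have := hmin x hx
  rw [inner_sub_right]; linarith

/-- When the interior nodal values are a large constant, no interior node is supported strictly. -/
theorem exists_strictSubdifferential_const_eq_empty (hB : B.Finite)
    (hNB : Disjoint (N : Set (Space d)) B) (hNint : (N : Set (Space d)) ⊆ convexHull ℝ B)
    (g : Space d → ℝ) :
    ∃ c : ℝ, ∀ A ∈ N, strictSubdifferential (N ∪ B) (nodalExtend N g fun _ => c) A = ∅ := by
  obtain ⟨G, hG⟩ := (hB.image g).bddAbove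
  refine ⟨G, fun A hA => eq_empty_of_forall_notMem fun p hp => ?_⟩
  have hconv : Convex ℝ {y : Space d | innerₛₗ ℝ p y < inner ℝ p A} :=
    convex_halfSpace_lt (innerₛₗ ℝ p).isLinear _
  have hBs : B ⊆ {y : Space d | innerₛₗ ℝ p y < inner ℝ p A} := by
    intro b hb
    have hbN : b ∉ N := fun h' => (Set.disjoint_left.1 hNB) h' hb
    have h1 := hp b (Or.inr hb) fun h => hbN (h ▸ hA)
    rw [nodalExtend_of_notMem _ _ hbN, nodalExtend_coe N g _ ⟨A, hA⟩, inner_sub_right] at h1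
    have h2 := hG (mem_image_of_mem g hb)
    change inner ℝ p b < inner ℝ p A
    linarith
  have hlt : inner ℝ p A < inner ℝ p A := convexHull_min hBs hconv (hNint hA)
  exact lt_irrefl _ hlt

/-- Upper semicontinuity of the mass of the subdifferential at `A` under a decrease of the value
at `A`. -/
theorem exists_pos_measure_subdifferential_update_lt [DecidableEq (Space d)]
    [IsFiniteMeasureOnCompacts ν]
    (hB : B.Finite) (hNint : (N : Set (Space d)) ⊆ interior (convexHull ℝ B)) (g : Space d → ℝ)
    (z : N → ℝ) (A : N) {c : ENNReal}
    (hc : ν (subdifferential (N ∪ B) (nodalExtend N g z) A) < c) :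
    ∃ t > 0, ν (subdifferential (N ∪ B)
      (nodalExtend N g (Function.update z A (z A - t))) A) < c := by
  set w := nodalExtend N g z with hw
  let s : ℕ → Set (Space d) := fun n => subdifferential (N ∪ B)
      (nodalExtend N g (Function.update z A (z A - 1 / ((n : ℝ) + 1)))) A
  have hs : ∀ n p, p ∈ s n ↔ ∀ x ∈ (N : Set (Space d)) ∪ B, x ≠ A →
      w A - 1 / ((n : ℝ) + 1) + inner ℝ p (x - A) ≤ w x := by
    intro n p
    refine forall₂_congr fun x hx => ?_
    rw [nodalExtend_update, nodalExtend_update, if_pos rfl, hw, nodalExtend_coe]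
    by_cases h : x = A
    · simp [h]
    · simp [h]
  have hlim : Filter.Tendsto (fun n : ℕ => 1 / ((n : ℝ) + 1)) Filter.atTop (nhds 0) :=
    tendsto_one_div_add_atTop_nhds_zero_nat
  have hanti : Antitone s := by
    intro a b hab p hp
    rw [hs] at hp ⊢
    intro x hx hxA
    have := hp x hx hxA
    have h2 : 1 / ((b : ℝ) + 1) ≤ 1 / ((a : ℝ) + 1) := by gcongr
    linarith
  have hInter : ⋂ n, s n = subdifferential (N ∪ B) w A := by
    ext p
    simp only [mem_iInter, hs]
    constructor
    · intro h x hx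
      by_cases hxA : x = A
      · simp [hxA]
      have h1 : Filter.Tendsto (fun n : ℕ => w A - 1 / ((n : ℝ) + 1) + inner ℝ p (x - A))
          Filter.atTop (nhds (w A - 0 + inner ℝ p (x - A))) :=
        (hlim.const_sub _).add_const _
      rw [sub_zero] at h1
      exact le_of_tendsto' h1 fun n => h n x hx hxA
    · intro h n x hx _
      have : (0 : ℝ) < 1 / ((n : ℝ) + 1) := by positivity
      linarith [h x hx]
  have hfin : ν (s 0) ≠ ⊤ :=
    ((isBounded_subdifferential hB subset_union_right _ (hNint A.2)).measure_lt_top).ne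
  have ht := tendsto_measure_iInter_atTop (μ := ν)
    (fun n => (isClosed_subdifferential _ _ _).measurableSet.nullMeasurableSet) hanti ⟨0, hfin⟩
  rw [hInter] at ht
  obtain ⟨n, hn⟩ := (ht.eventually_lt_const hc).exists
  exact ⟨1 / ((n : ℝ) + 1), by positivity, hn⟩

/-- Existence of nodal values with prescribed subdifferential masses. Among the nodal values whose
masses are at most the prescribed ones, one with the smallest sum is a solution: where the mass is
too small, the value can be lowered, which does not increase the masses at the other nodes. -/
theorem exists_measure_subdifferential_eq [IsFiniteMeasureOnCompacts ν] (hν : ν ≪ volume)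
    (hB : B.Finite) (hNB : Disjoint (N : Set (Space d)) B)
    (hNint : (N : Set (Space d)) ⊆ interior (convexHull ℝ B)) (g : Space d → ℝ)
    {m : Space d → ENNReal} (hm : ∑ A ∈ N, m A < ν univ) :
    ∃ w : Space d → ℝ, EqOn w g B ∧ ∀ A ∈ N, ν (subdifferential (N ∪ B) w A) = m A := by
  classical
  have hX : ((N : Set (Space d)) ∪ B).Finite := N.finite_toSet.union hB
  obtain ⟨n, hn⟩ : ∃ n : ℕ, ∑ A ∈ N, m A < ν (Metric.ball 0 n) := by
    have h1 : Monotone fun n : ℕ => Metric.ball (0 : Space d) n := fun a b hab =>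
      Metric.ball_subset_ball (by exact_mod_cast hab)
    rw [← Metric.iUnion_ball_nat (0 : Space d), h1.measure_iUnion] at hm
    exact lt_iSup_iff.1 hm
  obtain ⟨L, hL⟩ := exists_forall_le_of_sum_measure_lt (ν := ν) hB hNB g (ρ := n)
  obtain ⟨c, hc⟩ := exists_strictSubdifferential_const_eq_empty hB hNB
    (hNint.trans interior_subset) g
  set 𝒜 : Set (N → ℝ) :=
    {z | ∀ A : N, ν (strictSubdifferential (N ∪ B) (nodalExtend N g z) A) ≤ m A} with h𝒜
  have hlow : ∀ z ∈ 𝒜, ∀ A, L ≤ z A := by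
    refine fun z hz => hL z (lt_of_le_of_lt (Finset.sum_le_sum fun A hA => ?_) hn)
    rw [← measure_strictSubdifferential hν hX]
    exact hz ⟨A, hA⟩
  have hclosed : IsClosed 𝒜 := by
    have : 𝒜 = ⋂ A : N,
        {z : N → ℝ | ν (strictSubdifferential (N ∪ B) (nodalExtend N g z) A) ≤ m A} := by
      ext z; simp [h𝒜]
    rw [this]
    exact isClosed_iInter fun A =>
      isClosed_setOf_measure_strictSubdifferential_le _ hX g A (m A)
  have hcmem : (fun _ => c) ∈ 𝒜 := fun A => by simp [hc A A.2]
  have hcomp : IsCompact (𝒜 ∩ Icc (fun _ => L) (fun _ => c)) :=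
    isCompact_Icc.inter_left hclosed
  obtain ⟨z, ⟨hz, hzI⟩, hmin⟩ := hcomp.exists_isMinOn
    ⟨_, hcmem, fun A => hlow _ hcmem A, le_refl _⟩
    (f := fun z => ∑ A, z A) (by fun_prop)
  refine ⟨nodalExtend N g z, fun x hx => nodalExtend_of_notMem g z fun h' =>
    (Set.disjoint_left.1 hNB) h' hx, fun A hA => ?_⟩
  refine le_antisymm ?_ (le_of_not_gt fun hlt => ?_)
  · rw [← measure_strictSubdifferential hν hX]
    exact hz ⟨A, hA⟩
  obtain ⟨t, ht, htlt⟩ :=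
    exists_pos_measure_subdifferential_update_lt hB hNint g z ⟨A, hA⟩ hlt
  -- Lowering the value at `A` only tightens the constraints at the other nodes.
  set z' := Function.update z ⟨A, hA⟩ (z ⟨A, hA⟩ - t) with hz'
  have hle : ∀ A', z' A' ≤ z A' := by
    intro A'
    rw [hz', Function.update_apply]
    split_ifs with h
    · rw [h]; linarith
    · exact le_rfl
  have hz'mem : z' ∈ 𝒜 := by
    intro A'
    by_cases h : A' = ⟨A, hA⟩
    · rw [h, measure_strictSubdifferential hν hX]
      exact htlt.le
    refine (measure_mono fun p hp x hx hxA => ?_).trans (hz A')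
    have h1 := hp x hx hxA
    have hne : (A' : Space d) ≠ A := fun h' => h (Subtype.ext h')
    rw [hz', nodalExtend_update, nodalExtend_update, if_neg hne] at h1
    split_ifs at h1 with hxA'
    · rw [hxA'] at h1 ⊢
      have := nodalExtend_coe N g z ⟨A, hA⟩
      simp only at this h1 ⊢
      linarith
    · exact h1
  have hsum := hmin (⟨hz'mem, fun A' => hlow _ hz'mem A',
    fun A' => (hle A').trans (hzI.2 A')⟩ : z' ∈ 𝒜 ∩ Icc (fun _ => L) (fun _ => c))
  have hlt' : ∑ A', z' A' < ∑ A', z A' :=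
    Finset.sum_lt_sum (fun A' _ => hle A') ⟨⟨A, hA⟩, Finset.mem_univ _, by
      rw [hz', Function.update_self]; linarith⟩
  exact absurd hsum (not_le.2 hlt')

end Existence

end FEM

/-! ### Geometry of the mesh and nodal basis functions -/

namespace FEM

variable {d : ℕ}

theorem isCompact_simplex (s : Finset (Space d)) : IsCompact (simplex s) :=
  s.finite_toSet.isCompact_convexHull ℝ

theorem mem_simplex_of_mem {s : Finset (Space d)} {v : Space d} (hv : v ∈ s) : v ∈ simplex s :=
  subset_convexHull ℝ _ hv

theorem affineMap_le_of_mem_simplex {s : Finset (Space d)} {L : Space d →ᵃ[ℝ] ℝ} {c : ℝ}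
    (h : ∀ v ∈ s, L v ≤ c) : ∀ x ∈ simplex s, L x ≤ c :=
  convexHull_min h ((convex_Iic c).affine_preimage L)

theorem le_affineMap_of_mem_simplex {s : Finset (Space d)} {L : Space d →ᵃ[ℝ] ℝ} {c : ℝ}
    (h : ∀ v ∈ s, c ≤ L v) : ∀ x ∈ simplex s, c ≤ L x :=
  convexHull_min h ((convex_Ici c).affine_preimage L)

theorem affineMap_eqOn_simplex {s : Finset (Space d)} {L L' : Space d →ᵃ[ℝ] ℝ}
    (h : ∀ v ∈ s, L v = L' v) : EqOn L L' (simplex s) := by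
  intro x hx
  have h1 := affineMap_le_of_mem_simplex (L := L - L') (c := 0) (fun v hv => by simp [h v hv]) x hx
  have h2 := le_affineMap_of_mem_simplex (L := L - L') (c := 0) (fun v hv => by simp [h v hv]) x hx
  have h3 := le_antisymm h1 h2
  simpa [sub_eq_zero] using h3

namespace IsMesh

variable {Ω : Set (Space d)} {h : ℝ} {T : Finset (Finset (Space d))}

/-- The dimension is positive, as the mesh size is. -/
theorem nontrivial_space (hT : IsMesh Ω h T) : Nontrivial (Space d) := by
  by_contra hn
  rw [not_nontrivial_iff_subsingleton] at hn
  obtain ⟨s, _, hs⟩ := hT.size_eq.1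
  have := hT.size_pos
  rw [hs, Metric.diam_subsingleton (subsingleton_of_subsingleton)] at this
  exact lt_irrefl _ this

theorem affineSpan_eq_top (hT : IsMesh Ω h T) {s : Finset (Space d)} (hs : s ∈ T) :
    affineSpan ℝ (range ((↑) : s → Space d)) = ⊤ := by
  rw [(hT.affineIndependent s hs).affineSpan_eq_top_iff_card_eq_finrank_add_one]
  simp [hT.card_eq s hs]

/-- The barycentric coordinate system of a simplex of the mesh. -/
def affineBasis (hT : IsMesh Ω h T) {s : Finset (Space d)} (hs : s ∈ T) :
    AffineBasis s ℝ (Space d) :=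
  ⟨(↑), hT.affineIndependent s hs, hT.affineSpan_eq_top hs⟩

theorem simplex_eq (hT : IsMesh Ω h T) {s : Finset (Space d)} (hs : s ∈ T) :
    simplex s = {x | ∀ v : s, 0 ≤ (hT.affineBasis hs).coord v x} := by
  rw [← AffineBasis.convexHull_eq_nonneg_coord]
  exact congrArg (convexHull ℝ) Subtype.range_coe.symm

theorem exists_affineMap_interpolating (hT : IsMesh Ω h T) {s : Finset (Space d)} (hs : s ∈ T)
    (f : Space d → ℝ) : ∃ L : Space d →ᵃ[ℝ] ℝ, ∀ v ∈ s, L v = f v := by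
  classical
  refine ⟨∑ v : s, f v • (hT.affineBasis hs).coord v, fun v hv => ?_⟩
  have hco : ∀ v' : s, (hT.affineBasis hs).coord v' v = if v' = ⟨v, hv⟩ then 1 else 0 :=
    fun v' => (hT.affineBasis hs).coord_apply v' ⟨v, hv⟩
  have : ∀ t : Finset s, (∑ v' ∈ t, f v' • (hT.affineBasis hs).coord v') v =
      ∑ v' ∈ t, f v' * (hT.affineBasis hs).coord v' v := by
    intro t
    induction t using Finset.induction_on with
    | empty => simp
    | insert a t ha ih => simp [Finset.sum_insert ha, ih]
  rw [this]
  simp [hco]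

theorem isCompact_iUnion_simplex (T : Finset (Finset (Space d))) :
    IsCompact (⋃ s ∈ T, simplex s) :=
  T.isCompact_biUnion fun s _ => isCompact_simplex s

theorem meshDomain_eq (T : Finset (Finset (Space d))) :
    meshDomain T = interior (⋃ s ∈ T, simplex s) := by
  rw [meshDomain, (isCompact_iUnion_simplex T).isClosed.closure_eq]

theorem isOpen_meshDomain (T : Finset (Finset (Space d))) : IsOpen (meshDomain T) :=
  isOpen_interior

/-- Every simplex of the mesh is the closure of its interior. -/
theorem closure_meshDomain (hT : IsMesh Ω h T) :
    closure (meshDomain T) = ⋃ s ∈ T, simplex s := by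
  rw [meshDomain_eq]
  refine subset_antisymm ?_ (iUnion₂_subset fun s hs => ?_)
  · exact closure_minimal interior_subset (isCompact_iUnion_simplex T).isClosed
  · have hint : (interior (simplex s)).Nonempty := by
      rw [simplex, interior_convexHull_nonempty_iff_affineSpan_eq_top]
      simpa using hT.affineSpan_eq_top hs
    have := (convex_convexHull ℝ (s : Set (Space d))).closure_interior_eq_closure_of_nonempty_interior
      hint
    calc simplex s ⊆ closure (simplex s) := _root_.subset_closure
      _ = closure (interior (simplex s)) := this.symm
      _ ⊆ _ := closure_mono (interior_mono (subset_biUnion_of_mem (u := simplex) hs))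

theorem simplex_subset_closure (hT : IsMesh Ω h T) {s : Finset (Space d)} (hs : s ∈ T) :
    simplex s ⊆ closure (meshDomain T) := by
  rw [hT.closure_meshDomain]
  exact subset_biUnion_of_mem (u := simplex) hs

theorem isCompact_closure (hT : IsMesh Ω h T) : IsCompact (closure (meshDomain T)) := by
  rw [hT.closure_meshDomain]
  exact isCompact_iUnion_simplex T

theorem interior_closure (hT : IsMesh Ω h T) :
    interior (closure (meshDomain T)) = meshDomain T := by
  rw [hT.closure_meshDomain, meshDomain_eq]

theorem finite_interiorNodes (T : Finset (Finset (Space d))) : (interiorNodes T).Finite := by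
  refine (T.finite_toSet.biUnion fun s _ => s.finite_toSet).subset ?_
  rintro A ⟨⟨s, hs, hA⟩, -⟩
  exact mem_biUnion hs hA

/-- An extreme point of the polytope is an extreme point, hence a vertex, of any simplex containing
it. -/
theorem finite_boundaryVertices (hT : IsMesh Ω h T) : (boundaryVertices T).Finite := by
  refine (T.finite_toSet.biUnion fun s _ => s.finite_toSet).subset ?_
  intro B hB
  have hmem : B ∈ ⋃ s ∈ T, simplex s := hT.closure_meshDomain ▸ hB.1
  obtain ⟨s, hs, hBs⟩ := mem_iUnion₂.1 hmem
  have : B ∈ (simplex s).extremePoints ℝ :=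
    inter_extremePoints_subset_extremePoints_of_subset (hT.simplex_subset_closure hs) ⟨hBs, hB⟩
  exact mem_biUnion hs (extremePoints_convexHull_subset this)

/-- The Krein–Milman theorem; the closure is superfluous as there are finitely many vertices. -/
theorem convexHull_boundaryVertices (hT : IsMesh Ω h T) :
    convexHull ℝ (boundaryVertices T) = closure (meshDomain T) := by
  have := closure_convexHull_extremePoints hT.isCompact_closure hT.convex_domain.closure
  exact (hT.finite_boundaryVertices.isClosed_convexHull ℝ).closure_eq.symm.trans this

theorem meshDomain_subset (hT : IsMesh Ω h T) (hΩ_open : IsOpen Ω) (hΩ_convex : Convex ℝ Ω) :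
    meshDomain T ⊆ Ω := by
  have h1 : meshDomain T ⊆ interior (closure Ω) := by
    rw [meshDomain_eq]
    exact interior_mono (iUnion₂_subset hT.subset_closure)
  rcases Ω.eq_empty_or_nonempty with h0 | h0
  · simpa [h0] using h1
  · rwa [hΩ_convex.interior_closure_eq_interior_of_nonempty_interior
      (by rwa [hΩ_open.interior_eq]), hΩ_open.interior_eq] at h1

theorem disjoint_interiorNodes_boundaryVertices (hT : IsMesh Ω h T) (hΩ_open : IsOpen Ω)
    (hΩ_convex : Convex ℝ Ω) : Disjoint (interiorNodes T) (boundaryVertices T) := by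
  refine Set.disjoint_left.2 fun A hA hB => ?_
  have := hT.boundaryVertices_subset hB
  rw [hΩ_open.frontier_eq] at this
  exact this.2 (hT.meshDomain_subset hΩ_open hΩ_convex hA.2)

theorem interiorNodes_subset (hT : IsMesh Ω h T) :
    interiorNodes T ⊆ interior (convexHull ℝ (boundaryVertices T)) := by
  rw [hT.convexHull_boundaryVertices, hT.interior_closure]
  exact fun A hA => hA.2

theorem vertex_mem_interiorNodes_or_frontier (hT : IsMesh Ω h T) {s : Finset (Space d)} (hs : s ∈ T)
    {v : Space d} (hv : v ∈ s) : v ∈ interiorNodes T ∨ v ∈ frontier (meshDomain T) := by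
  by_cases hm : v ∈ meshDomain T
  · exact Or.inl ⟨⟨s, hs, hv⟩, hm⟩
  · right
    rw [(isOpen_meshDomain T).frontier_eq]
    exact ⟨hT.simplex_subset_closure hs (mem_simplex_of_mem hv), hm⟩

/-- Continuous piecewise affine interpolation of nodal values. On the common face of two simplices
the two affine interpolants agree, since they agree at the vertices of the face. -/
theorem exists_piecewise_affine (hT : IsMesh Ω h T) (f : Space d → ℝ) :
    ∃ φ : Space d → ℝ, ContinuousOn φ (closure (meshDomain T)) ∧
      ∀ s ∈ T, ∃ L : Space d →ᵃ[ℝ] ℝ, EqOn φ L (simplex s) ∧ ∀ v ∈ s, L v = f v := by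
  classical
  choose! L hL using fun s (hs : s ∈ T) => hT.exists_affineMap_interpolating hs f
  have hcompat : ∀ s ∈ T, ∀ t ∈ T, ∀ x ∈ simplex s, x ∈ simplex t → L s x = L t x := by
    intro s hs t ht x hxs hxt
    by_cases hst : s = t
    · rw [hst]
    obtain ⟨e, hes, het, he⟩ := hT.face_to_face s hs t ht hst
    have hx : x ∈ simplex e := he ▸ ⟨hxs, hxt⟩
    exact affineMap_eqOn_simplex (fun v hv => by rw [hL s hs v (hes hv), hL t ht v (het hv)]) hx
  let φ : Space d → ℝ := fun x =>
    if hx : ∃ s ∈ T, x ∈ simplex s then L hx.choose x else 0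
  have hφ : ∀ s ∈ T, EqOn φ (L s) (simplex s) := by
    intro s hs x hx
    have hex : ∃ s ∈ T, x ∈ simplex s := ⟨s, hs, hx⟩
    simp only [φ, dif_pos hex]
    exact hcompat _ hex.choose_spec.1 s hs x hex.choose_spec.2 hx
  refine ⟨φ, ?_, fun s hs => ⟨L s, hφ s hs, hL s hs⟩⟩
  rw [hT.closure_meshDomain]
  have hfin : LocallyFinite fun s : T => simplex (s : Finset (Space d)) := locallyFinite_of_finite _
  have := hfin.continuousOn_iUnion (g := φ) (fun s => (isCompact_simplex _).isClosed)
    fun s => (L s).continuous_of_finiteDimensional.continuousOn.congr (hφ s s.2)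
  rwa [iUnion_subtype (fun s => s ∈ T) fun s => simplex (s : Finset (Space d))] at this

/-- The interpolant of the indicator of `A` vanishes on the frontier: a frontier point of the convex
set `Ω_h` has zero barycentric coordinate with respect to every vertex in `Ω_h`. -/
theorem exists_isNodalBasisFunction (hT : IsMesh Ω h T) {A : Space d} (hA : A ∈ interiorNodes T) :
    ∃ φ, IsNodalBasisFunction T A φ := by
  classical
  obtain ⟨φ, hcont, hφ⟩ := hT.exists_piecewise_affine fun v => if v = A then 1 else 0
  have hval : ∀ s ∈ T, ∀ v ∈ s, φ v = if v = A then 1 else 0 := by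
    intro s hs v hv
    obtain ⟨L, hL, hLv⟩ := hφ s hs
    rw [hL (mem_simplex_of_mem hv), hLv v hv]
  refine ⟨φ, hcont, ?_, fun s hs => (hφ s hs).imp fun L hL => hL.1, ?_, ?_⟩
  · intro x hx
    rw [(isOpen_meshDomain T).frontier_eq, hT.closure_meshDomain] at hx
    obtain ⟨s, hs, hxs⟩ := mem_iUnion₂.1 hx.1
    obtain ⟨L, hL, hLv⟩ := hφ s hs
    rw [hL hxs]
    -- Convexity of this set carries the implication from the vertices to the whole simplex.
    have hconv : Convex ℝ {y | y ∈ closure (meshDomain T) ∧ 0 ≤ L y ∧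
        (0 < L y → y ∈ meshDomain T)} := by
      have hP := hT.convex_domain.closure
      have hint := hT.interior_closure
      refine convex_iff_forall_pos.2 ?_
      rintro y ⟨hy, hy0, hy1⟩ y' ⟨hy', hy'0, hy'1⟩ a b ha hb hab
      have hlin : L (a • y + b • y') = a * L y + b * L y' := by
        simpa using Convex.combo_affine_apply (f := L) hab
      refine ⟨hP hy hy' ha.le hb.le hab, by rw [hlin]; positivity, fun hpos => ?_⟩
      rw [hlin] at hpos
      by_cases hy2 : 0 < L y
      · rw [← hint]
        exact hP.combo_interior_self_mem_interior (by rw [hint]; exact hy1 hy2) hy' ha hb.le hab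
      · have h0 : L y = 0 := le_antisymm (not_lt.1 hy2) hy0
        rw [h0, mul_zero, zero_add] at hpos
        rw [← hint]
        exact hP.combo_self_interior_mem_interior hy
          (by rw [hint]; exact hy'1 (pos_of_mul_pos_right hpos hb.le)) ha.le hb hab
    have hmem := convexHull_min (s := (s : Set (Space d))) (fun v hv => ?_) hconv hxs
    · exact le_antisymm (not_lt.1 fun hpos => hx.2 (hmem.2.2 hpos)) hmem.2.1
    · refine ⟨hT.simplex_subset_closure hs (mem_simplex_of_mem hv), ?_, ?_⟩
      · rw [hLv v hv]; split_ifs <;> norm_num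
      · rw [hLv v hv]
        split_ifs with hvA
        · exact fun _ => hvA ▸ hA.2
        · exact fun h0 => absurd h0 (lt_irrefl _)
  · obtain ⟨⟨s, hs, hAs⟩, -⟩ := hA
    simp [hval s hs A hAs]
  · rintro A' ⟨⟨s, hs, hAs⟩, -⟩ hne
    simp [hval s hs A' hAs, hne]

end IsMesh

namespace IsNodalBasisFunction

variable {Ω : Set (Space d)} {h : ℝ} {T : Finset (Finset (Space d))} {A : Space d}
  {φ ψ : Space d → ℝ}

theorem apply_vertex (hφ : IsNodalBasisFunction T A φ) (hT : IsMesh Ω h T)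
    {s : Finset (Space d)} (hs : s ∈ T)
    {v : Space d} (hv : v ∈ s) [Decidable (v = A)] : φ v = if v = A then 1 else 0 := by
  split_ifs with h
  · rw [h, hφ.eq_one]
  · rcases hT.vertex_mem_interiorNodes_or_frontier hs hv with h' | h'
    · exact hφ.eq_zero_of_ne v h' h
    · exact hφ.eq_zero v h'

theorem eqOn (hφ : IsNodalBasisFunction T A φ) (hψ : IsNodalBasisFunction T A ψ)
    (hT : IsMesh Ω h T) : EqOn φ ψ (closure (meshDomain T)) := by
  classical
  intro x hx
  rw [hT.closure_meshDomain] at hx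
  obtain ⟨s, hs, hxs⟩ := mem_iUnion₂.1 hx
  obtain ⟨L, hL⟩ := hφ.affine s hs
  obtain ⟨L', hL'⟩ := hψ.affine s hs
  rw [hL hxs, hL' hxs]
  refine affineMap_eqOn_simplex (fun v hv => ?_) hxs
  rw [← hL (mem_simplex_of_mem hv), ← hL' (mem_simplex_of_mem hv), hφ.apply_vertex hT hs hv,
    hψ.apply_vertex hT hs hv]

theorem nonneg (hφ : IsNodalBasisFunction T A φ) (hT : IsMesh Ω h T)
    {x : Space d} (hx : x ∈ closure (meshDomain T)) : 0 ≤ φ x := by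
  classical
  rw [hT.closure_meshDomain] at hx
  obtain ⟨s, hs, hxs⟩ := mem_iUnion₂.1 hx
  obtain ⟨L, hL⟩ := hφ.affine s hs
  rw [hL hxs]
  refine le_affineMap_of_mem_simplex (fun v hv => ?_) x hxs
  rw [← hL (mem_simplex_of_mem hv), hφ.apply_vertex hT hs hv]
  split_ifs <;> norm_num

end IsNodalBasisFunction

theorem IsMesh.sum_nodalBasis_le_one {Ω : Set (Space d)} {h : ℝ} {T : Finset (Finset (Space d))}
    (hT : IsMesh Ω h T) {N : Finset (Space d)} {φ : Space d → Space d → ℝ}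
    (hφ : ∀ A ∈ N, IsNodalBasisFunction T A (φ A))
    {x : Space d} (hx : x ∈ closure (meshDomain T)) : ∑ A ∈ N, φ A x ≤ 1 := by
  classical
  rw [hT.closure_meshDomain] at hx
  obtain ⟨s, hs, hxs⟩ := mem_iUnion₂.1 hx
  choose! L hL using fun A (hA : A ∈ N) => (hφ A hA).affine s hs
  have hsum : ∀ N' : Finset (Space d), ∀ y, (∑ A ∈ N', L A) y = ∑ A ∈ N', L A y := by
    intro N' y
    induction N' using Finset.induction_on with
    | empty => simp
    | insert a t ha ih => simp [Finset.sum_insert ha, ih]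
  rw [Finset.sum_congr rfl fun A hA => hL A hA hxs, ← hsum]
  refine affineMap_le_of_mem_simplex (fun v hv => ?_) x hxs
  rw [hsum, Finset.sum_congr rfl fun A hA =>
    ((hL A hA (mem_simplex_of_mem hv)).symm.trans ((hφ A hA).apply_vertex hT hs hv)),
    Finset.sum_ite_eq]
  split_ifs <;> norm_num

end FEM

/-! ### Lower envelopes and the space `H_h` -/

namespace FEM

variable {d : ℕ} {Ω : Set (Space d)} {h : ℝ} {T : Finset (Finset (Space d))}
  {g z : Space d → ℝ}

theorem mem_hullM_of_mem_interiorNodes {A : Space d} (hA : A ∈ interiorNodes T) :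
    (A, z A) ∈ hullM T g z :=
  subset_convexHull ℝ _ (Or.inl (mem_image_of_mem _ hA))

theorem mem_hullM_of_mem_boundaryVertices {B : Space d} (hB : B ∈ boundaryVertices T) :
    (B, g B) ∈ hullM T g z :=
  subset_convexHull ℝ _ (Or.inr (mem_image_of_mem _ hB))

theorem hullM_subset {C : Set (Space d × ℝ)} (hC : Convex ℝ C)
    (hN : ∀ A ∈ interiorNodes T, (A, z A) ∈ C) (hB : ∀ B ∈ boundaryVertices T, (B, g B) ∈ C) :
    hullM T g z ⊆ C := by
  refine convexHull_min ?_ hC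
  rintro _ (⟨A, hA, rfl⟩ | ⟨B, hB', rfl⟩)
  exacts [hN A hA, hB B hB']

theorem hullM_congr {z' : Space d → ℝ} (hz : EqOn z z' (interiorNodes T)) :
    hullM T g z = hullM T g z' := by
  rw [hullM, hullM]
  congr 2
  exact image_congr fun A hA => by rw [hz hA]

theorem isCompact_hullM (hT : IsMesh Ω h T) (g z : Space d → ℝ) : IsCompact (hullM T g z) :=
  (((IsMesh.finite_interiorNodes T).image _).union
    (hT.finite_boundaryVertices.image _)).isCompact_convexHull ℝ

theorem fst_image_hullM (hT : IsMesh Ω h T) (g z : Space d → ℝ) :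
    Prod.fst '' hullM T g z = closure (meshDomain T) := by
  refine subset_antisymm ?_ ?_
  · rintro _ ⟨q, hq, rfl⟩
    have hC : Convex ℝ {q : Space d × ℝ | q.1 ∈ closure (meshDomain T)} :=
      hT.convex_domain.closure.linear_preimage (LinearMap.fst ℝ (Space d) ℝ)
    exact hullM_subset hC (fun A hA => subset_closure hA.2) (fun B hB => hB.1) hq
  · rw [← hT.convexHull_boundaryVertices]
    refine convexHull_min (fun B hB => ⟨_, mem_hullM_of_mem_boundaryVertices hB, rfl⟩) ?_
    exact (convex_convexHull ℝ _).linear_image (LinearMap.fst ℝ (Space d) ℝ)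

theorem le_of_mem_hullM {p x₀ : Space d} {c : ℝ}
    (hN : ∀ A ∈ interiorNodes T, c + inner ℝ p (A - x₀) ≤ z A)
    (hB : ∀ B ∈ boundaryVertices T, c + inner ℝ p (B - x₀) ≤ g B) {x : Space d} {t : ℝ}
    (hx : (x, t) ∈ hullM T g z) : c + inner ℝ p (x - x₀) ≤ t := by
  let f : Space d × ℝ →ₗ[ℝ] ℝ :=
    (innerₛₗ ℝ p) ∘ₗ LinearMap.fst ℝ (Space d) ℝ - LinearMap.snd ℝ (Space d) ℝ
  have hf : ∀ y s, f (y, s) = inner ℝ p y - s := fun y s => rfl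
  have key : hullM T g z ⊆ {q | f q ≤ inner ℝ p x₀ - c} := by
    refine hullM_subset (convex_halfSpace_le f.isLinear _) (fun A hA => ?_) fun B hB' => ?_
    · have := hN A hA
      rw [inner_sub_right] at this
      change f (A, z A) ≤ _
      rw [hf]; linarith
    · have := hB B hB'
      rw [inner_sub_right] at this
      change f (B, g B) ≤ _
      rw [hf]; linarith
  have := key hx
  change f (x, t) ≤ _ at this
  rw [hf] at this
  rw [inner_sub_right]; linarith

theorem lt_of_mem_hullM {p x₀ : Space d} {c : ℝ}
    (hN : ∀ A ∈ interiorNodes T, c + inner ℝ p (A - x₀) < z A)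
    (hB : ∀ B ∈ boundaryVertices T, c + inner ℝ p (B - x₀) < g B) {x : Space d} {t : ℝ}
    (hx : (x, t) ∈ hullM T g z) : c + inner ℝ p (x - x₀) < t := by
  let f : Space d × ℝ →ₗ[ℝ] ℝ :=
    (innerₛₗ ℝ p) ∘ₗ LinearMap.fst ℝ (Space d) ℝ - LinearMap.snd ℝ (Space d) ℝ
  have hf : ∀ y s, f (y, s) = inner ℝ p y - s := fun y s => rfl
  have key : hullM T g z ⊆ {q | f q < inner ℝ p x₀ - c} := by
    refine hullM_subset (convex_halfSpace_lt f.isLinear _) (fun A hA => ?_) fun B hB' => ?_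
    · have := hN A hA
      rw [inner_sub_right] at this
      change f (A, z A) < _
      rw [hf]; linarith
    · have := hB B hB'
      rw [inner_sub_right] at this
      change f (B, g B) < _
      rw [hf]; linarith
  have := key hx
  change f (x, t) < _ at this
  rw [hf] at this
  rw [inner_sub_right]; linarith

/-- Over an extreme point of the polytope the fibre of `M_h(z)` is a single point. -/
theorem eq_of_mem_hullM_of_mem_boundaryVertices (hT : IsMesh Ω h T)
    (hNB : Disjoint (interiorNodes T) (boundaryVertices T)) {B : Space d}
    (hB : B ∈ boundaryVertices T) {t : ℝ} (ht : (B, t) ∈ hullM T g z) : t = g B := by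
  have hC : Convex ℝ {q : Space d × ℝ | q.1 ∈ closure (meshDomain T) ∧ (q.1 = B → q.2 = g B)} := by
    refine convex_iff_forall_pos.2 ?_
    rintro ⟨x, s⟩ ⟨hx, hxs⟩ ⟨y, r⟩ ⟨hy, hyr⟩ a b ha hb hab
    refine ⟨hT.convex_domain.closure hx hy ha.le hb.le hab, fun hq => ?_⟩
    have hq' : a • x + b • y = B := hq
    obtain ⟨h1, h2⟩ := (mem_extremePoints.1 hB).2 x hx y hy ⟨a, b, ha, hb, hab, hq'⟩
    have e1 : s = g B := hxs h1
    have e2 : r = g B := hyr h2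
    change a * s + b * r = g B
    rw [e1, e2, ← add_mul, hab, one_mul]
  refine (hullM_subset (T := T) (g := g) (z := z) hC (fun A hA => ⟨subset_closure hA.2, fun hAB =>
    absurd hB (Set.disjoint_left.1 hNB (by rw [← show A = B from hAB]; exact hA))⟩)
    (fun B' hB' => ⟨hB'.1, fun h' => ?_⟩) ht).2 rfl
  change g B' = g B
  rw [show B' = B from h']

section Envelope

variable {u : Space d → ℝ}

theorem IsLeast.of_isGLB_hullM (hT : IsMesh Ω h T)
    (hu : ∀ x ∈ closure (meshDomain T), IsGLB {t : ℝ | (x, t) ∈ hullM T g z} (u x))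
    {x : Space d} (hx : x ∈ closure (meshDomain T)) :
    IsLeast {t : ℝ | (x, t) ∈ hullM T g z} (u x) := by
  refine ⟨?_, (hu x hx).1⟩
  have hcl : IsClosed {t : ℝ | (x, t) ∈ hullM T g z} :=
    (isCompact_hullM hT g z).isClosed.preimage (by fun_prop : Continuous fun t : ℝ => (x, t))
  have hne : {t : ℝ | (x, t) ∈ hullM T g z}.Nonempty := by
    rw [← fst_image_hullM hT g z] at hx
    obtain ⟨⟨x', t⟩, hq, rfl⟩ := hx
    exact ⟨t, hq⟩
  exact hcl.closure_subset ((hu x hx).mem_closure hne)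

theorem exists_isGLB_hullM (hT : IsMesh Ω h T) (g z : Space d → ℝ) :
    ∃ u : Space d → ℝ,
      ∀ x ∈ closure (meshDomain T), IsGLB {t : ℝ | (x, t) ∈ hullM T g z} (u x) := by
  refine ⟨fun x => sInf {t : ℝ | (x, t) ∈ hullM T g z}, fun x hx => isGLB_csInf ?_ ?_⟩
  · rw [← fst_image_hullM hT g z] at hx
    obtain ⟨⟨x', t⟩, hq, rfl⟩ := hx
    exact ⟨t, hq⟩
  · obtain ⟨c, hc⟩ := ((isCompact_hullM hT g z).image continuous_snd).bddBelow
    exact ⟨c, fun t ht => hc ⟨_, ht, rfl⟩⟩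

theorem convexOn_of_isGLB_hullM (hT : IsMesh Ω h T)
    (hu : ∀ x ∈ closure (meshDomain T), IsGLB {t : ℝ | (x, t) ∈ hullM T g z} (u x)) :
    ConvexOn ℝ (closure (meshDomain T)) u := by
  refine ⟨hT.convex_domain.closure, fun x hx y hy a b ha hb hab => ?_⟩
  refine (hu _ (hT.convex_domain.closure hx hy ha hb hab)).1 ?_
  exact (convex_convexHull ℝ _) (IsLeast.of_isGLB_hullM hT hu hx).1
    (IsLeast.of_isGLB_hullM hT hu hy).1 ha hb hab

/-- A simplex is locally conical: near a point `x` of a simplex, dilating with centre `x` by a given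
factor does not leave the simplex. -/
theorem IsMesh.eventually_add_smul_sub_mem_simplex (hT : IsMesh Ω h T) {s : Finset (Space d)}
    (hs : s ∈ T) {x : Space d} (hx : x ∈ simplex s) {k : ℝ} (hk : 0 ≤ k) :
    ∀ᶠ y in nhdsWithin x (simplex s), x + k • (y - x) ∈ simplex s := by
  have hlin : ∀ (v : s) (y : Space d), (hT.affineBasis hs).coord v (x + k • (y - x)) =
      (hT.affineBasis hs).coord v x +
        k * ((hT.affineBasis hs).coord v y - (hT.affineBasis hs).coord v x) := by
    intro v y
    have h1 := AffineMap.apply_lineMap ((hT.affineBasis hs).coord v) x y k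
    rw [AffineMap.lineMap_apply, AffineMap.lineMap_apply] at h1
    simp only [vsub_eq_sub, vadd_eq_add, smul_eq_mul] at h1
    rw [add_comm x, h1, add_comm]
  have hx' := hx
  rw [hT.simplex_eq hs] at hx'
  have hev : ∀ v : s, ∀ᶠ y in nhdsWithin x (simplex s),
      0 ≤ (hT.affineBasis hs).coord v (x + k • (y - x)) := by
    intro v
    rcases (hx' v).eq_or_lt with h0 | h0
    · filter_upwards [self_mem_nhdsWithin] with y hy
      rw [hT.simplex_eq hs] at hy
      rw [hlin, ← h0, zero_add, sub_zero]
      exact mul_nonneg hk (hy v)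
    · have hc : Continuous fun y => (hT.affineBasis hs).coord v (x + k • (y - x)) :=
        ((hT.affineBasis hs).coord v).continuous_of_finiteDimensional.comp (by fun_prop)
      have : ∀ᶠ y in nhds x, 0 < (hT.affineBasis hs).coord v (x + k • (y - x)) :=
        continuousAt_const.eventually_lt hc.continuousAt (by simpa using h0)
      exact (this.filter_mono nhdsWithin_le_nhds).mono fun y hy => hy.le
  filter_upwards [Filter.eventually_all.2 hev] with y hy
  rw [hT.simplex_eq hs]
  exact hy

/-- Upper semicontinuity at the boundary rests on the polytope being locally conical, lower
semicontinuity on the compactness of `M_h(z)`. -/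
theorem continuousOn_of_isGLB_hullM (hT : IsMesh Ω h T)
    (hu : ∀ x ∈ closure (meshDomain T), IsGLB {t : ℝ | (x, t) ∈ hullM T g z} (u x)) :
    ContinuousOn u (closure (meshDomain T)) := by
  intro x hx
  refine tendsto_order.2 ⟨fun a ha => ?_, fun c hc => ?_⟩
  · have hcomp : IsCompact (Prod.fst '' (hullM T g z ∩ {q | q.2 ≤ a})) :=
      ((isCompact_hullM hT g z).inter_right (isClosed_le continuous_snd continuous_const)).image
        continuous_fst
    have hxn : x ∈ (Prod.fst '' (hullM T g z ∩ {q | q.2 ≤ a}))ᶜ := by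
      rintro ⟨⟨x', t⟩, ⟨hq, ht⟩, rfl⟩
      exact absurd (((hu _ hx).1 hq).trans ht) (not_le.2 ha)
    filter_upwards [nhdsWithin_le_nhds (hcomp.isClosed.isOpen_compl.mem_nhds hxn),
      self_mem_nhdsWithin] with y hy hyP
    by_contra! hle
    exact hy ⟨(y, u y), ⟨(IsLeast.of_isGLB_hullM hT hu hyP).1, hle⟩, rfl⟩
  · obtain ⟨C, hC⟩ := ((isCompact_hullM hT g z).image continuous_snd).bddAbove
    have hCu : ∀ y ∈ closure (meshDomain T), u y ≤ C := fun y hy =>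
      hC ⟨_, (IsLeast.of_isGLB_hullM hT hu hy).1, rfl⟩
    -- `y` divides the segment from `x` to its dilation by the factor `k` in the ratio `1 : k - 1`.
    obtain ⟨k, hk, hkc⟩ : ∃ k : ℝ, 1 ≤ k ∧ u x + (1 / k) * (C - u x) < c := by
      refine ⟨1 + (C - u x) / (c - u x), ?_, ?_⟩
      · have := div_nonneg (sub_nonneg.2 (hCu x hx)) (sub_nonneg.2 hc.le)
        linarith
      · have h1 : 0 < c - u x := sub_pos.2 hc
        have h2 : 0 ≤ C - u x := sub_nonneg.2 (hCu x hx)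
        have h3 : 1 + (C - u x) / (c - u x) = (c - u x + (C - u x)) / (c - u x) := by
          field_simp
        rw [h3, one_div_div, ← lt_sub_iff_add_lt', div_mul_eq_mul_div, div_lt_iff₀ (by linarith)]
        nlinarith
    have hk0 : 0 < k := by linarith
    have hmain : ∀ s ∈ T, ∀ᶠ y in nhdsWithin x (simplex s), u y < c := by
      intro s hs
      by_cases hxs : x ∈ simplex s
      · filter_upwards [hT.eventually_add_smul_sub_mem_simplex hs hxs hk0.le] with y hy
        have hk1 : 0 ≤ 1 - 1 / k := by rw [sub_nonneg, div_le_one hk0]; exact hk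
        have hk2 : 0 ≤ 1 / k := by positivity
        have hconv := (convexOn_of_isGLB_hullM hT hu).2 hx (hT.simplex_subset_closure hs hy)
          hk1 hk2 (by ring)
        have e : (1 - 1 / k) • x + (1 / k) • (x + k • (y - x)) = y := by
          rw [smul_add, smul_smul, one_div, inv_mul_cancel₀ hk0.ne']
          module
        rw [e, smul_eq_mul, smul_eq_mul] at hconv
        have h1 := mul_le_mul_of_nonneg_left (hCu _ (hT.simplex_subset_closure hs hy)) hk2
        linarith
      · have : (simplex s)ᶜ ∈ nhdsWithin x (simplex s) :=
          nhdsWithin_le_nhds ((isCompact_simplex s).isClosed.isOpen_compl.mem_nhds hxs)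
        filter_upwards [this, self_mem_nhdsWithin] with y hy hy'
        exact absurd hy' hy
    have hnhds : nhdsWithin x (closure (meshDomain T)) = ⨆ s ∈ T, nhdsWithin x (simplex s) := by
      rw [hT.closure_meshDomain]
      exact nhdsWithin_biUnion T.finite_toSet simplex x
    rw [hnhds, Filter.eventually_iSup]
    exact fun s => Filter.eventually_iSup.2 fun hs => hmain s hs

theorem mem_spaceH_of_isGLB_hullM (hT : IsMesh Ω h T)
    (hu : ∀ x ∈ closure (meshDomain T), IsGLB {t : ℝ | (x, t) ∈ hullM T g z} (u x)) :
    u ∈ spaceH T g :=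
  ⟨(convexOn_of_isGLB_hullM hT hu).subset subset_closure hT.convex_domain,
    continuousOn_of_isGLB_hullM hT hu, z, hu⟩

end Envelope

section SpaceH

variable {u : Space d → ℝ}

theorem eqOn_boundaryVertices_of_mem_spaceH (hT : IsMesh Ω h T)
    (hNB : Disjoint (interiorNodes T) (boundaryVertices T)) (hu : u ∈ spaceH T g) :
    EqOn u g (boundaryVertices T) := by
  obtain ⟨-, -, z, hz⟩ := hu
  exact fun B hB => eq_of_mem_hullM_of_mem_boundaryVertices hT hNB hB
    (IsLeast.of_isGLB_hullM hT hz hB.1).1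

/-- A function of `H_h` is the lower envelope of its own nodal values. -/
theorem isGLB_hullM_self_of_mem_spaceH (hT : IsMesh Ω h T) (hu : u ∈ spaceH T g) :
    ∀ x ∈ closure (meshDomain T), IsGLB {t : ℝ | (x, t) ∈ hullM T g u} (u x) := by
  obtain ⟨-, -, z, hz⟩ := hu
  intro x hx
  obtain ⟨u', hu'⟩ := exists_isGLB_hullM hT g u
  have hsub : hullM T g u ⊆ hullM T g z :=
    hullM_subset (convex_convexHull ℝ _)
      (fun A hA => (IsLeast.of_isGLB_hullM hT hz (subset_closure hA.2)).1)
      fun B hB => mem_hullM_of_mem_boundaryVertices hB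
  refine ⟨fun t ht => (hz x hx).1 (hsub ht), fun c hc => ?_⟩
  have hepi : Convex ℝ {q : Space d × ℝ | q.1 ∈ closure (meshDomain T) ∧ u' q.1 ≤ q.2} :=
    (convexOn_of_isGLB_hullM hT hu').convex_epigraph
  have hsub' : hullM T g z ⊆ {q | q.1 ∈ closure (meshDomain T) ∧ u' q.1 ≤ q.2} := by
    refine hullM_subset hepi (fun A hA => ⟨subset_closure hA.2, ?_⟩) fun B hB => ⟨hB.1, ?_⟩
    · exact ((hu' A (subset_closure hA.2)).1 (mem_hullM_of_mem_interiorNodes hA)).trans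
        ((hz A (subset_closure hA.2)).1 (mem_hullM_of_mem_interiorNodes hA))
    · exact (hu' B hB.1).1 (mem_hullM_of_mem_boundaryVertices hB)
  exact (hc (IsLeast.of_isGLB_hullM hT hu' hx).1).trans
    (hsub' (IsLeast.of_isGLB_hullM hT hz hx).1).2

theorem eqOn_closure_of_eqOn_interiorNodes (hT : IsMesh Ω h T) {v : Space d → ℝ}
    (hu : u ∈ spaceH T g) (hv : v ∈ spaceH T g) (huv : EqOn u v (interiorNodes T)) :
    EqOn u v (closure (meshDomain T)) := by
  intro x hx
  have h1 := isGLB_hullM_self_of_mem_spaceH hT hu x hx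
  have h2 := isGLB_hullM_self_of_mem_spaceH hT hv x hx
  rw [← hullM_congr huv] at h2
  exact h1.unique h2

/-- A subgradient inequality for a function of `H_h` has to be checked at the nodes only. -/
theorem subdifferential_meshDomain_eq (hT : IsMesh Ω h T)
    (hNB : Disjoint (interiorNodes T) (boundaryVertices T)) (hu : u ∈ spaceH T g) (A : Space d) :
    subdifferential (meshDomain T) u A =
      subdifferential (interiorNodes T ∪ boundaryVertices T) u A := by
  refine subset_antisymm (fun p hp => ?_) fun p hp x hx => ?_
  · have hcl : ∀ x ∈ closure (meshDomain T), u A + inner ℝ p (x - A) ≤ u x := fun x hx =>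
      ContinuousWithinAt.closure_le hx
        (by fun_prop : Continuous fun x => u A + inner ℝ p (x - A)).continuousWithinAt
        ((hu.2.1 x hx).mono subset_closure) hp
    rintro x (hx | hx)
    exacts [hcl x (subset_closure hx.2), hcl x hx.1]
  · have hglb := isGLB_hullM_self_of_mem_spaceH hT hu x (subset_closure hx)
    have hB := eqOn_boundaryVertices_of_mem_spaceH hT hNB hu
    refine hglb.2 fun t ht => le_of_mem_hullM (fun A' hA' => hp A' (Or.inl hA')) ?_ ht
    exact fun B hB' => hB hB' ▸ hp B (Or.inr hB')

/-- A convex function has a subgradient at every point of an open domain. -/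
theorem subdifferential_nonempty {D : Set (Space d)} (hD : IsOpen D) (hu : ConvexOn ℝ D u)
    {A : Space d} (hA : A ∈ D) : (subdifferential D u A).Nonempty := by
  have hcont : ContinuousOn u D := hu.continuousOn hD
  have hopen : IsOpen {q : Space d × ℝ | q.1 ∈ D ∧ u q.1 < q.2} := by
    have h1 : ContinuousOn (fun q : Space d × ℝ => q.2 - u q.1) (Prod.fst ⁻¹' D) :=
      continuousOn_snd.sub (hcont.comp continuousOn_fst fun q hq => hq)
    have h2 := h1.isOpen_inter_preimage (hD.preimage continuous_fst) isOpen_Ioi (t := Ioi 0)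
    convert h2 using 1
    ext q
    simp
  -- Separate the strict epigraph from the point of the graph above `A`.
  obtain ⟨f, hf⟩ := geometric_hahn_banach_open_point hu.convex_strict_epigraph hopen
    (x := (A, u A)) fun hmem => lt_irrefl _ hmem.2
  have hsplit : ∀ x t, f (x, t) = f (x, 0) + t * f (0, 1) := by
    intro x t
    have : ((x, t) : Space d × ℝ) = (x, 0) + t • (0, 1) := by simp
    rw [this, map_add, map_smul, smul_eq_mul]
  have hneg : f (0, 1) < 0 := by
    have := hf (A, u A + 1) ⟨hA, by simp⟩
    rw [hsplit A (u A + 1), hsplit A (u A)] at this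
    linarith
  have hle : ∀ x ∈ D, f (x, 0) + u x * f (0, 1) ≤ f (A, 0) + u A * f (0, 1) := by
    intro x hx
    have hlim : Filter.Tendsto (fun t : ℝ => f (x, 0) + t * f (0, 1)) (nhdsWithin (u x) (Ioi (u x)))
        (nhds (f (x, 0) + u x * f (0, 1))) :=
      (by fun_prop : Continuous fun t : ℝ => f (x, 0) + t * f (0, 1)).continuousWithinAt
    refine le_of_tendsto hlim ?_
    filter_upwards [self_mem_nhdsWithin] with t ht
    have := hf (x, t) ⟨hx, ht⟩
    rw [hsplit x t, hsplit A (u A)] at this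
    exact this.le
  let ℓ : Space d →L[ℝ] ℝ := f.comp (ContinuousLinearMap.inl ℝ (Space d) ℝ)
  refine ⟨(-(f (0, 1))⁻¹) • (InnerProductSpace.toDual ℝ (Space d)).symm ℓ, fun x hx => ?_⟩
  have hℓ : ∀ y, ℓ y = f (y, 0) := fun y => rfl
  rw [real_inner_smul_left, InnerProductSpace.toDual_symm_apply, map_sub, hℓ, hℓ]
  have h1 := hle x hx
  have h2 : (f (0, 1))⁻¹ < 0 := inv_lt_zero.2 hneg
  have h3 : f (0, 1) * (f (0, 1))⁻¹ = 1 := mul_inv_cancel₀ hneg.ne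
  have h4 := mul_le_mul_of_nonpos_right h1 h2.le
  have e1 : (f (x, 0) + u x * f (0, 1)) * (f (0, 1))⁻¹ = f (x, 0) * (f (0, 1))⁻¹ + u x := by
    rw [add_mul, mul_assoc, h3, mul_one]
  have e2 : (f (A, 0) + u A * f (0, 1)) * (f (0, 1))⁻¹ = f (A, 0) * (f (0, 1))⁻¹ + u A := by
    rw [add_mul, mul_assoc, h3, mul_one]
  rw [e1, e2] at h4
  linarith

end SpaceH

/-- The lower envelope and the nodal function itself have the same subdifferential at an interior
node up to a null set. They agree if the envelope attains the nodal value; otherwise every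
subgradient of the envelope is in contact with another node, hence lies on a hyperplane. -/
theorem measure_subdifferential_envelope (hT : IsMesh Ω h T)
    (hNB : Disjoint (interiorNodes T) (boundaryVertices T)) {ν : Measure (Space d)}
    (hν : ν ≪ volume) (hz : EqOn z g (boundaryVertices T)) {u : Space d → ℝ}
    (hu : ∀ x ∈ closure (meshDomain T), IsGLB {t : ℝ | (x, t) ∈ hullM T g z} (u x))
    {A : Space d} (hA : A ∈ interiorNodes T) :
    ν (subdifferential (meshDomain T) u A) =
      ν (subdifferential (interiorNodes T ∪ boundaryVertices T) z A) := by
  have huH := mem_spaceH_of_isGLB_hullM hT hu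
  have hX := (IsMesh.finite_interiorNodes T).union hT.finite_boundaryVertices
  have huz : ∀ x ∈ interiorNodes T, u x ≤ z x := fun x hx =>
    (hu x (subset_closure hx.2)).1 (mem_hullM_of_mem_interiorNodes hx)
  have huB := eqOn_boundaryVertices_of_mem_spaceH hT hNB huH
  have hmemA := (IsLeast.of_isGLB_hullM hT hu (subset_closure hA.2)).1
  refine le_antisymm ?_ (measure_mono fun p hp x hx => ?_)
  · have hdiff : ν (subdifferential (meshDomain T) u A \
        subdifferential (interiorNodes T ∪ boundaryVertices T) z A) = 0 := by
      refine measure_eq_zero_of_forall_exists_inner_eq hν hX (A := A) (fun x => z x - u A) ?_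
      rintro p ⟨hp, hp'⟩
      rw [subdifferential_meshDomain_eq hT hNB huH] at hp
      have hpz : ∀ x ∈ interiorNodes T ∪ boundaryVertices T, u A + inner ℝ p (x - A) ≤ z x := by
        rintro x (hx | hx)
        · exact (hp x (Or.inl hx)).trans (huz x hx)
        · rw [hz hx, ← huB hx]; exact hp x (Or.inr hx)
      have hlt : u A < z A := by
        refine lt_of_le_of_ne (huz A hA) fun heq => hp' ?_
        rw [subdifferential, ← heq]
        exact hpz
      by_contra! hno
      have hstrict : ∀ x ∈ interiorNodes T ∪ boundaryVertices T,
          u A + inner ℝ p (x - A) < z x := by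
        intro x hx
        by_cases hxA : x = A
        · rw [hxA]; simpa using hlt
        · exact lt_of_le_of_ne (hpz x hx) fun h' => hno x hx hxA (by linarith)
      have := lt_of_mem_hullM (fun A' hA' => hstrict A' (Or.inl hA'))
        (fun B hB => hz hB ▸ hstrict B (Or.inr hB)) hmemA
      simp at this
    calc _ ≤ ν (subdifferential (interiorNodes T ∪ boundaryVertices T) z A ∪
          subdifferential (meshDomain T) u A \
            subdifferential (interiorNodes T ∪ boundaryVertices T) z A) :=
          measure_mono fun p hp => by
            by_cases h : p ∈ subdifferential (interiorNodes T ∪ boundaryVertices T) z A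
            exacts [Or.inl h, Or.inr ⟨hp, h⟩]
      _ ≤ _ := measure_union_le _ _
      _ = _ := by rw [hdiff, add_zero]
  · have hlow := (hu x (subset_closure hx)).2 fun t ht =>
      le_of_mem_hullM (fun A' hA' => hp A' (Or.inl hA'))
        (fun B hB => hz hB ▸ hp B (Or.inr hB)) ht
    linarith [huz A hA]

end FEM

/-! ### The discrete scheme -/

namespace FEM

variable {d : ℕ}

theorem isFiniteMeasureOnCompacts_withDensity_ofReal {R : Space d → ℝ}
    (hR : LocallyIntegrable R volume) :
    IsFiniteMeasureOnCompacts (volume.withDensity fun p => ENNReal.ofReal (R p)) := by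
  refine ⟨fun K hK => ?_⟩
  rw [withDensity_apply _ hK.isClosed.measurableSet]
  exact (hR.integrableOn_isCompact hK).lintegral_lt_top

theorem IsMesh.sum_setLIntegral_nodalBasis_le {Ω : Set (Space d)} {h : ℝ}
    {T : Finset (Finset (Space d))} (hT : IsMesh Ω h T) (μ : Measure (Space d))
    {N : Finset (Space d)} {φ : Space d → Space d → ℝ}
    (hφ : ∀ A ∈ N, IsNodalBasisFunction T A (φ A)) :
    ∑ A ∈ N, ∫⁻ x in meshDomain T, ENNReal.ofReal (φ A x) ∂μ ≤ μ (meshDomain T) := by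
  have hm : MeasurableSet (meshDomain T) := (IsMesh.isOpen_meshDomain T).measurableSet
  rw [← lintegral_finsetSum' _ fun A hA =>
    (((hφ A hA).continuousOn.mono _root_.subset_closure).aemeasurable hm).ennreal_ofReal]
  refine (setLIntegral_mono measurable_const fun x hx => ?_).trans_eq (setLIntegral_one _)
  rw [← ENNReal.ofReal_sum_of_nonneg fun A hA => (hφ A hA).nonneg hT (_root_.subset_closure hx)]
  exact ENNReal.ofReal_le_one.2 (hT.sum_nodalBasis_le_one hφ (_root_.subset_closure hx))

theorem setLIntegral_ofReal_nodalBasis_congr {Ω : Set (Space d)} {h : ℝ}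
    {T : Finset (Finset (Space d))} (hT : IsMesh Ω h T) (μ : Measure (Space d)) {A : Space d}
    {φ ψ : Space d → ℝ} (hφ : IsNodalBasisFunction T A φ) (hψ : IsNodalBasisFunction T A ψ) :
    ∫⁻ x in meshDomain T, ENNReal.ofReal (φ x) ∂μ =
      ∫⁻ x in meshDomain T, ENNReal.ofReal (ψ x) ∂μ :=
  setLIntegral_congr_fun (IsMesh.isOpen_meshDomain T).measurableSet fun x hx => by
    simp only [hφ.eqOn hψ hT (_root_.subset_closure hx)]

end FEM

theorem mainTheorem4 {d : ℕ} (Ω : Set (FEM.Space d)) (hΩ_open : IsOpen Ω)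
    (hΩ_convex : Convex ℝ Ω) (hΩ_bdd : Bornology.IsBounded Ω)
    (hΩ_strict : FEM.IsStrictlyConvexDomain Ω)
    (μ : Measure (FEM.Space d))
    (R : FEM.Space d → ℝ) (hR : LocallyIntegrable R volume) (hR_pos : ∀ p, 0 < R p)
    (g : FEM.Space d → ℝ)
    (hμ : μ Ω < ∫⁻ p, ENNReal.ofReal (R p))
    (h : ℝ) (T : Finset (Finset (FEM.Space d))) (hT : FEM.IsMesh Ω h T) :
    (∃ u : FEM.Space d → ℝ, FEM.IsDiscreteSolution T μ R g u) ∧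
      ∀ u v : FEM.Space d → ℝ, FEM.IsDiscreteSolution T μ R g u →
        FEM.IsDiscreteSolution T μ R g v → EqOn u v (closure (FEM.meshDomain T)) := by
  open FEM in
  have := hT.nontrivial_space
  set ν : Measure (Space d) := volume.withDensity fun p => ENNReal.ofReal (R p) with hν_def
  have : IsFiniteMeasureOnCompacts ν := isFiniteMeasureOnCompacts_withDensity_ofReal hR
  have hν : ν ≪ volume := withDensity_absolutelyContinuous _ _
  have hν' : volume ≪ ν := withDensity_absolutelyContinuous'
    hR.aestronglyMeasurable.aemeasurable.ennreal_ofReal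
    (Filter.Eventually.of_forall fun p => (ENNReal.ofReal_pos.2 (hR_pos p)).ne')
  have hν_apply : ∀ (D : Set (Space d)) (u : Space d → ℝ) (A : Space d),
      ∫⁻ p in subdifferential D u A, ENNReal.ofReal (R p) = ν (subdifferential D u A) :=
    fun D u A => (withDensity_apply _ (isClosed_subdifferential D u A).measurableSet).symm
  have hNB := hT.disjoint_interiorNodes_boundaryVertices hΩ_open hΩ_convex
  have hNfin := IsMesh.finite_interiorNodes T
  have hBfin := hT.finite_boundaryVertices
  have hNint := hT.interiorNodes_subset
  have hNmem : ∀ A ∈ hNfin.toFinset, A ∈ interiorNodes T := fun A hA => hNfin.mem_toFinset.1 hA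
  choose! φ hφ using fun A (hA : A ∈ interiorNodes T) => hT.exists_isNodalBasisFunction hA
  have hmass : ∑ A ∈ hNfin.toFinset, ∫⁻ x in meshDomain T, ENNReal.ofReal (φ A x) ∂μ ≤ μ Ω :=
    (hT.sum_setLIntegral_nodalBasis_le μ fun A hA => hφ A (hNmem A hA)).trans
      (measure_mono (hT.meshDomain_subset hΩ_open hΩ_convex))
  have hν_univ : μ Ω < ν univ := by rwa [hν_def, withDensity_apply _ MeasurableSet.univ,
    Measure.restrict_univ]
  refine ⟨?_, ?_⟩
  · obtain ⟨z, hzB, hz⟩ := exists_measure_subdifferential_eq (N := hNfin.toFinset)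
      (B := boundaryVertices T) hν hBfin (by simpa using hNB) (by simpa using hNint) g
      (hmass.trans_lt hν_univ)
    obtain ⟨u, hu⟩ := exists_isGLB_hullM hT g z
    refine ⟨u, mem_spaceH_of_isGLB_hullM hT hu, fun A hA => ⟨φ A, hφ A hA, ?_⟩⟩
    -- The envelope need not attain the nodal values `z`, but no mass is lost.
    rw [hν_apply, measure_subdifferential_envelope hT hNB hν hzB hu hA,
      ← hz A (hNfin.mem_toFinset.2 hA), hNfin.coe_toFinset]
  · have hsol : ∀ u, IsDiscreteSolution T μ R g u → ∀ A ∈ interiorNodes T,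
        ν (subdifferential (interiorNodes T ∪ boundaryVertices T) u A) =
          ∫⁻ x in meshDomain T, ENNReal.ofReal (φ A x) ∂μ := by
      rintro u ⟨huH, hu⟩ A hA
      obtain ⟨ψ, hψ, heq⟩ := hu A hA
      rw [← subdifferential_meshDomain_eq hT hNB huH, ← hν_apply, heq,
        setLIntegral_ofReal_nodalBasis_congr hT μ hψ (hφ A hA)]
    have hle : ∀ u v, IsDiscreteSolution T μ R g u → IsDiscreteSolution T μ R g v →
        ∀ A ∈ interiorNodes T, v A ≤ u A := by
      intro u v hu hv
      refine le_of_measure_subdifferential_eq hν' hNfin hBfin hNint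
        (fun B hB => ?_) (fun A hA => by rw [hsol u hu A hA, hsol v hv A hA])
        (fun A hA => ?_) fun A hA => ?_
      · rw [eqOn_boundaryVertices_of_mem_spaceH hT hNB hu.1 hB,
          eqOn_boundaryVertices_of_mem_spaceH hT hNB hv.1 hB]
      · rw [hsol v hv A hA]
        refine ne_top_of_le_ne_top (hμ.trans_le le_top).ne (le_trans ?_ hmass)
        exact Finset.single_le_sum
          (f := fun A => ∫⁻ x in meshDomain T, ENNReal.ofReal (φ A x) ∂μ)
          (fun _ _ => zero_le) (hNfin.mem_toFinset.2 hA)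
      · rw [← subdifferential_meshDomain_eq hT hNB hv.1]
        exact subdifferential_nonempty (IsMesh.isOpen_meshDomain T) hv.1.1 hA.2
    exact fun u v hu hv => eqOn_closure_of_eqOn_interiorNodes hT hu.1 hv.1 fun A hA =>
      le_antisymm (hle v u hv hu A hA) (hle u v hu hv A hA)
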